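/- Let $X$ be a (real or complex) Banach space. A \emph{projectional skeleton} on $X$ is a family $(P_s)_{s\in\Gamma}$ of bounded linear projections on $X$, indexed by an up-directed partially ordered set $\Gamma$, such that (i) $P_sX$ is separable for every $s\in\Gamma$; (ii) $P_sP_t=P_tP_s=P_s$ whenever $s\le t$; (iii) for every increasing sequence $(s_n)$ in $\Gamma$ the supremum $s=\sup_n s_n$ exists in $\Gamma$ and $P_sX=\overline{\bigcup_n P_{s_n}X}$; (iv) $X=\bigcup_{s\in\Gamma}P_sX$. The subspace of $X^*$ \emph{induced by} the skeleton is $\bigcup_{s\in\Gamma}P_s^*X^*$, and the skeleton is \emph{full} if this subspace is all of $X^*$. A subspace $D\subset X^*$ is a \emph{$\Sigma$-subspace} of $X^*$ if there is a set $M\subset X$ with dense linear span such that $D=\{x^*\in X^*: \{x\in M: x^*(x)\neq 0\}\text{ is countable}\}$, and $X$ is \emph{weakly Lindel\"of determined} if $X^*$ is a $\Sigma$-subspace of itself. Corollary. If a Banach space $X$ has a full projectional skeleton, then $X^*$ is a $\Sigma$-subspace of itself, i.e., $X$ is weakly Lindel\"of determined. -/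

import Mathlib

/-- The family `(P s)` of bounded linear operators on `X`, indexed by the partially ordered set
`Γ`, is a projectional skeleton on `X`. -/
structure IsProjectionalSkeleton {𝕜 X Γ : Type*} [RCLike 𝕜] [NormedAddCommGroup X]
    [NormedSpace 𝕜 X] [PartialOrder Γ] (P : Γ → X →L[𝕜] X) : Prop where
  /-- the index set is up-directed -/
  directed : ∀ s t : Γ, ∃ u : Γ, s ≤ u ∧ t ≤ u
  /-- each `P s` is a projection -/
  projection : ∀ s, (P s).comp (P s) = P s
  /-- each `P s` has separable range -/
  separable : ∀ s, TopologicalSpace.IsSeparable (Set.range (P s))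
  /-- the projections are compatible with the order -/
  compatible : ∀ s t, s ≤ t → (P s).comp (P t) = P s ∧ (P t).comp (P s) = P s
  /-- suprema of increasing sequences exist, and the ranges are continuous along them -/
  sigma_complete : ∀ σ : ℕ → Γ, Monotone σ → ∃ s, IsLUB (Set.range σ) s ∧
    Set.range (P s) = closure (⋃ n, Set.range (P (σ n)))
  /-- the ranges cover `X` -/
  cover : (⋃ s, Set.range (P s)) = Set.univ

namespace IsProjectionalSkeleton

variable {𝕜 X Γ : Type*} [RCLike 𝕜] [NormedAddCommGroup X] [NormedSpace 𝕜 X] [PartialOrder Γ]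
  {P : Γ → X →L[𝕜] X}

/-- The subspace `⋃ s, (P s)^* X^*` of the dual `X^*` induced by a projectional skeleton. -/
def inducedSubspace (hP : IsProjectionalSkeleton P) : Submodule 𝕜 (StrongDual 𝕜 X) where
  carrier := ⋃ s, Set.range fun f : StrongDual 𝕜 X => f.comp (P s)
  zero_mem' := by
    have h : (0 : X) ∈ ⋃ s, Set.range (P s) := by rw [hP.cover]; trivial
    obtain ⟨s, -⟩ := Set.mem_iUnion.1 h
    exact Set.mem_iUnion.2 ⟨s, 0, by ext; simp⟩
  add_mem' := by
    intro a b ha hb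
    obtain ⟨s, f, rfl⟩ := Set.mem_iUnion.1 ha
    obtain ⟨t, g, rfl⟩ := Set.mem_iUnion.1 hb
    obtain ⟨u, hsu, htu⟩ := hP.directed s t
    refine Set.mem_iUnion.2 ⟨u, f.comp (P s) + g.comp (P t), ?_⟩
    ext x
    have h1 := DFunLike.congr_fun (hP.compatible s u hsu).1 x
    have h2 := DFunLike.congr_fun (hP.compatible t u htu).1 x
    simp only [ContinuousLinearMap.comp_apply] at h1 h2
    simp [h1, h2]
  smul_mem' := by
    intro c a ha
    obtain ⟨s, f, rfl⟩ := Set.mem_iUnion.1 ha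
    exact Set.mem_iUnion.2 ⟨s, c • f, by ext; simp⟩

end IsProjectionalSkeleton

/-- A subspace `D` of `X^*` is a `Σ`-subspace of `X^*` if there is a linearly dense set `M ⊆ X`
such that `D` consists of the functionals that are nonzero at only countably many points
of `M`. -/
def IsSigmaSubspace {𝕜 X : Type*} [RCLike 𝕜] [NormedAddCommGroup X] [NormedSpace 𝕜 X]
    (D : Submodule 𝕜 (StrongDual 𝕜 X)) : Prop :=
  ∃ M : Set X, (Submodule.span 𝕜 M).topologicalClosure = ⊤ ∧
    (D : Set (StrongDual 𝕜 X)) = {f | {x ∈ M | f x ≠ 0}.Countable}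

/-- `X` is weakly Lindelöf determined if `X^*` is a `Σ`-subspace of itself. -/
def IsWeaklyLindelofDetermined (𝕜 X : Type*) [RCLike 𝕜] [NormedAddCommGroup X]
    [NormedSpace 𝕜 X] : Prop :=
  IsSigmaSubspace (⊤ : Submodule 𝕜 (StrongDual 𝕜 X))

open Filter Topology Set

/-! ### Uniformly bounded projections indexed by finite sets -/

namespace IsProjectionalSkeleton

variable {𝕜 X Γ : Type*} [RCLike 𝕜] [NormedAddCommGroup X] [NormedSpace 𝕜 X] [PartialOrder Γ]
  {P : Γ → X →L[𝕜] X}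

/-! Monotone upper bounds of finite index sets, taken among projections of uniformly bounded norm,
give compatible projections indexed by finite sets. Limits along the finite subsets of an arbitrary
B ⊆ Γ give projections `Q B`, with `Q univ` the identity.

Fullness enters in `exists_countable_comp`: f ∘ Q B is determined by a countable part of B. Hence,
along a well-ordered enumeration of B, f sees only countably many of the increments Q(≤ i) - Q(< i)
(`countable_setOf_ne`). By induction on the cardinality of B, the sets found for the initial
segments, mapped by these increments, assemble to a countably supported set whose closed span
contains the range of `Q B`. The theorem is the case B = Γ. -/

theorem apply_apply_of_le (hP : IsProjectionalSkeleton P) {s t : Γ} (h : s ≤ t) (x : X) :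
    P s (P t x) = P s x ∧ P t (P s x) = P s x :=
  ⟨DFunLike.congr_fun (hP.compatible s t h).1 x, DFunLike.congr_fun (hP.compatible s t h).2 x⟩

theorem nonempty (hP : IsProjectionalSkeleton P) : Nonempty Γ := by
  have h : (0 : X) ∈ ⋃ s, Set.range (P s) := by rw [hP.cover]; trivial
  obtain ⟨s, -⟩ := Set.mem_iUnion.1 h
  exact ⟨s⟩

theorem isDirectedOrder (hP : IsProjectionalSkeleton P) : IsDirectedOrder Γ := ⟨hP.directed⟩

theorem exists_monotone_ge (hP : IsProjectionalSkeleton P) (s : ℕ → Γ) :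
    ∃ σ : ℕ → Γ, Monotone σ ∧ ∀ n, s n ≤ σ n := by
  choose u hu₁ hu₂ using hP.directed
  let σ : ℕ → Γ := fun n => Nat.rec (s 0) (fun n t => u t (s (n + 1))) n
  refine ⟨σ, monotone_nat_of_le_succ fun n => hu₁ _ _, fun n => ?_⟩
  cases n with
  | zero => exact le_rfl
  | succ n => exact hu₂ _ _

/-- The projections of uniformly bounded norm are cofinal in a projectional skeleton. -/
theorem exists_norm_le (hP : IsProjectionalSkeleton P) :
    ∃ C : ℝ, ∀ s, ∃ t, s ≤ t ∧ ‖P t‖ ≤ C := by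
  by_contra! h
  -- Every projection above `s n` has norm exceeding n, so an upper bound of a sequence dominating
  -- all `s n` is impossible.
  choose s hs using fun n : ℕ => h n
  obtain ⟨σ, hσ, hsσ⟩ := hP.exists_monotone_ge s
  obtain ⟨t, ht, -⟩ := hP.sigma_complete σ hσ
  obtain ⟨n, hn⟩ := exists_nat_ge ‖P t‖
  exact absurd hn (not_le.2 (hs n t ((hsσ n).trans (ht.1 ⟨n, rfl⟩))))

/-- Bounded increasing sequences of projections of a skeleton converge pointwise. -/
theorem cauchySeq_apply (hP : IsProjectionalSkeleton P) {σ : ℕ → Γ} (hσ : Monotone σ) {C : ℝ}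
    (hC : ∀ n, ‖P (σ n)‖ ≤ C) (x : X) : CauchySeq fun n => P (σ n) x := by
  obtain ⟨s, hs, hr⟩ := hP.sigma_complete σ hσ
  have hle : ∀ n, σ n ≤ s := fun n => hs.1 ⟨n, rfl⟩
  have hC0 : 0 ≤ C := (norm_nonneg _).trans (hC 0)
  refine Tendsto.cauchySeq (x := P s x) ?_
  rw [Metric.tendsto_atTop]
  intro ε hε
  have hmem : P s x ∈ closure (⋃ n, range (P (σ n))) := hr ▸ mem_range_self x
  -- Both P s x and its image under `P (σ n)` are compared with one fixed vector: the errors have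
  -- factors 1 and C.
  obtain ⟨y, hy, hxy⟩ := Metric.mem_closure_iff.1 hmem (ε / (C + 1)) (by positivity)
  obtain ⟨N, z, rfl⟩ := mem_iUnion.1 hy
  refine ⟨N, fun n hn => ?_⟩
  have h1 : P (σ n) (P (σ N) z) = P (σ N) z := (hP.apply_apply_of_le (hσ hn) z).2
  have h2 : P (σ n) (P s x) = P (σ n) x := (hP.apply_apply_of_le (hle n) x).1
  have h3 : dist (P (σ n) (P s x)) (P (σ n) (P (σ N) z)) ≤ C * dist (P s x) (P (σ N) z) := by
    rw [dist_eq_norm, dist_eq_norm, ← map_sub]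
    exact (P (σ n)).le_of_opNorm_le (hC n) _
  rw [h1, h2] at h3
  calc dist (P (σ n) x) (P s x)
      ≤ dist (P (σ n) x) (P (σ N) z) + dist (P (σ N) z) (P s x) := dist_triangle _ _ _
    _ ≤ (C + 1) * dist (P s x) (P (σ N) z) := by rw [dist_comm (P (σ N) z)]; linarith
    _ < (C + 1) * (ε / (C + 1)) := by gcongr
    _ = ε := by field_simp

/-- Upper bounds of finite sets can be chosen monotonically and with uniformly bounded
projections. -/
theorem exists_finset_upperBound (hP : IsProjectionalSkeleton P) :
    ∃ (φ : Finset Γ → Γ) (C : ℝ), Monotone φ ∧ (∀ F, ∀ s ∈ F, s ≤ φ F) ∧ ∀ F, ‖P (φ F)‖ ≤ C := by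
  classical
  obtain ⟨C, hC⟩ := hP.exists_norm_le
  have := hP.nonempty
  have := hP.isDirectedOrder
  have hb : ∀ F : Finset Γ, ∃ t, (∀ s ∈ F, s ≤ t) ∧ ‖P t‖ ≤ C := fun F => by
    obtain ⟨s, hs⟩ := F.exists_le
    obtain ⟨t, hst, ht⟩ := hC s
    exact ⟨t, fun r hr => (hs r hr).trans hst, ht⟩
  choose b hb hbC using hb
  -- Bounding also the values at all proper subsets makes the recursively defined map monotone.
  let H : ∀ F : Finset Γ, (∀ G ⊂ F, Γ) → Γ := fun F φ =>
    b (F ∪ F.ssubsets.attach.image fun G => φ G.1 (Finset.mem_ssubsets.1 G.2))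
  let φ : Finset Γ → Γ := Finset.strongInduction H
  have hφ : ∀ F, φ F = H F fun G _ => φ G := fun F => Finset.strongInduction_eq H F
  refine ⟨φ, C, fun G F hGF => ?_, fun F s hs => ?_, fun F => ?_⟩
  · rcases eq_or_ssubset_of_subset (show G ⊆ F from hGF) with rfl | h
    · exact le_rfl
    · rw [hφ F]
      refine hb _ _ (Finset.mem_union_right _ (Finset.mem_image.2 ?_))
      exact ⟨⟨G, Finset.mem_ssubsets.2 h⟩, Finset.mem_attach _ _, rfl⟩
  · rw [hφ F]
    exact hb _ _ (Finset.mem_union_left _ hs)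
  · rw [hφ F]
    exact hbC _

end IsProjectionalSkeleton

/-- A uniformly bounded full projectional skeleton indexed by the finite subsets of `Γ`, in which
convergence along increasing sequences replaces the existence of suprema. -/
structure IsFinsetSkeleton {𝕜 X Γ : Type*} [RCLike 𝕜] [NormedAddCommGroup X]
    [NormedSpace 𝕜 X] (p : Finset Γ → X →L[𝕜] X) : Prop where
  /-- the projections are compatible with inclusion -/
  compatible : ∀ F G, F ⊆ G → ∀ x, p F (p G x) = p F x ∧ p G (p F x) = p F x
  bounded : ∃ C : ℝ, ∀ F, ‖p F‖ ≤ C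
  separable : ∀ F, TopologicalSpace.IsSeparable (range (p F))
  cauchySeq : ∀ F : ℕ → Finset Γ, Monotone F → ∀ x, CauchySeq fun n => p (F n) x
  cover : ∀ x, ∃ s, ∀ F, s ∈ F → p F x = x
  /-- every functional is induced -/
  full : ∀ f : StrongDual 𝕜 X, ∃ s, ∀ F, s ∈ F → ∀ x, f (p F x) = f x

theorem IsProjectionalSkeleton.exists_isFinsetSkeleton {𝕜 X Γ : Type*} [RCLike 𝕜]
    [NormedAddCommGroup X] [NormedSpace 𝕜 X] [PartialOrder Γ] {P : Γ → X →L[𝕜] X}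
    (hP : IsProjectionalSkeleton P) (hfull : hP.inducedSubspace = ⊤) :
    ∃ p : Finset Γ → X →L[𝕜] X, IsFinsetSkeleton p := by
  obtain ⟨φ, C, hφ, hle, hC⟩ := hP.exists_finset_upperBound
  refine ⟨fun F => P (φ F), fun F G h x => hP.apply_apply_of_le (hφ h) x, ⟨C, hC⟩,
    fun F => hP.separable _, fun F hF x => hP.cauchySeq_apply (hφ.comp hF) (fun n => hC _) x,
    fun x => ?_, fun f => ?_⟩
  · have hx : x ∈ ⋃ s, range (P s) := by rw [hP.cover]; trivial
    obtain ⟨s, y, rfl⟩ := mem_iUnion.1 hx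
    exact ⟨s, fun F hs => (hP.apply_apply_of_le (hle F s hs) y).2⟩
  · have hf : f ∈ hP.inducedSubspace := by rw [hfull]; trivial
    obtain ⟨s, g, rfl⟩ := mem_iUnion.1 hf
    refine ⟨s, fun F hs x => ?_⟩
    simp [(hP.apply_apply_of_le (hle F s hs) x).1]

/-! ### Projections indexed by arbitrary subsets -/

/-- A family of projections indexed by all subsets of `Γ`, extending a full finset-indexed
skeleton continuously. -/
structure IsSetSkeleton {𝕜 X Γ : Type*} [RCLike 𝕜] [NormedAddCommGroup X]
    [NormedSpace 𝕜 X] (Q : Set Γ → X →L[𝕜] X) : Prop where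
  /-- the projections are compatible with inclusion -/
  compatible : ∀ A B, A ⊆ B → ∀ x, Q A (Q B x) = Q A x ∧ Q B (Q A x) = Q A x
  separable : ∀ A, A.Countable → TopologicalSpace.IsSeparable (range (Q A))
  /-- the value of `Q B` at a point depends on a countable subset of `B` only -/
  exists_countable : ∀ B x, ∃ C ⊆ B, C.Countable ∧ ∀ E, C ⊆ E → E ⊆ B → Q E x = Q B x
  /-- the ranges are continuous along unions -/
  mem_closure : ∀ B x, Q B x ∈ closure (⋃ F : {F : Finset Γ // ↑F ⊆ B}, range (Q F))
  apply_univ : ∀ x, Q univ x = x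
  /-- every functional is induced -/
  full : ∀ f : StrongDual 𝕜 X, ∃ s, ∀ B, s ∈ B → ∀ x, f (Q B x) = f x

/-- The filter of large finite subsets of `B`. -/
def finsetsIn {Γ : Type*} (B : Set Γ) : Filter (Finset Γ) :=
  map (fun F : Finset B => F.map (Function.Embedding.subtype _)) atTop

instance {Γ : Type*} (B : Set Γ) : (finsetsIn B).NeBot := by
  unfold finsetsIn; infer_instance

theorem eventually_finsetsIn {Γ : Type*} {B : Set Γ} {q : Finset Γ → Prop} :
    (∀ᶠ F in finsetsIn B, q F) ↔
      ∃ G : Finset Γ, ↑G ⊆ B ∧ ∀ F : Finset Γ, ↑F ⊆ B → G ⊆ F → q F := by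
  classical
  simp only [finsetsIn, eventually_map, eventually_atTop]
  constructor
  · rintro ⟨G, hG⟩
    refine ⟨G.map (Function.Embedding.subtype _), by simp, fun F hF hGF => ?_⟩
    have h := hG (F.subtype (· ∈ B)) fun s hs => by
      simpa using hGF (Finset.mem_map_of_mem _ hs)
    rwa [Finset.subtype_map_of_mem (p := (· ∈ B)) fun s hs => hF hs] at h
  · rintro ⟨G, hGB, hG⟩
    refine ⟨G.subtype (· ∈ B), fun F hF => hG _ (by simp) fun s hs => ?_⟩
    exact Finset.mem_map.2 ⟨⟨s, hGB hs⟩, hF (by simpa using hs), rfl⟩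

namespace IsFinsetSkeleton

variable {𝕜 X Γ : Type*} [RCLike 𝕜] [NormedAddCommGroup X] [NormedSpace 𝕜 X]
  {p : Finset Γ → X →L[𝕜] X}

theorem exists_tendsto [CompleteSpace X] (hp : IsFinsetSkeleton p) (B : Set Γ) (x : X) :
    ∃ y, Tendsto (fun F => p F x) (finsetsIn B) (𝓝 y) := by
  let ι : Finset B → Finset Γ := fun F => F.map (Function.Embedding.subtype _)
  have hι : Monotone ι := fun F G h => Finset.map_subset_map.2 h
  suffices h : CauchySeq fun F : Finset B => p (ι F) x by
    obtain ⟨y, hy⟩ := cauchySeq_tendsto_of_complete h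
    exact ⟨y, tendsto_map'_iff.2 hy⟩
  classical
  rw [Metric.cauchySeq_iff']
  by_contra! h
  obtain ⟨ε, hε, h⟩ := h
  choose g hg hgε using h
  -- Iterating the failure of the Cauchy condition gives an increasing sequence with all jumps at
  -- least ε.
  let F : ℕ → Finset B := fun n => g^[n] ∅
  have hF : ∀ n, F (n + 1) = g (F n) := fun n => Function.iterate_succ_apply' _ _ _
  have hmono : Monotone F := monotone_nat_of_le_succ fun n => by rw [hF]; exact hg _
  obtain ⟨N, hN⟩ := Metric.cauchySeq_iff.1 (hp.cauchySeq _ (hι.comp hmono) x) ε hε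
  have h1 := hN (N + 1) (by simp) N le_rfl
  simp only [Function.comp_apply, hF] at h1
  exact absurd h1 (not_lt.2 (hgε _))

theorem exists_limit [CompleteSpace X] (hp : IsFinsetSkeleton p) :
    ∃ Q : Set Γ → X →L[𝕜] X, ∀ B x, Tendsto (fun F => p F x) (finsetsIn B) (𝓝 (Q B x)) := by
  obtain ⟨C, hC⟩ := hp.bounded
  choose q hq using hp.exists_tendsto
  refine ⟨fun B => ContinuousLinearMap.ofTendstoOfBoundedRange (q B) p
    (tendsto_pi_nhds.2 (hq B)) (isBounded_iff_forall_norm_le.2 ⟨C, ?_⟩), hq⟩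
  rintro _ ⟨F, rfl⟩
  exact hC F

theorem exists_isSetSkeleton [CompleteSpace X] (hp : IsFinsetSkeleton p) :
    ∃ Q : Set Γ → X →L[𝕜] X, IsSetSkeleton Q := by
  obtain ⟨Q, hQ⟩ := hp.exists_limit
  have hin : ∀ {B : Set Γ} {F : Finset Γ}, ↑F ⊆ B → ∀ x, p F (Q B x) = p F x ∧
      Q B (p F x) = p F x := by
    intro B F hF x
    constructor
    · refine tendsto_nhds_unique (((p F).continuous.tendsto _).comp (hQ B x))
        (tendsto_const_nhds.congr' (eventually_finsetsIn.2 ⟨F, hF, fun G _ hG => ?_⟩))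
      exact (hp.compatible F G hG x).1.symm
    · refine tendsto_nhds_unique (hQ B (p F x))
        (tendsto_const_nhds.congr' (eventually_finsetsIn.2 ⟨F, hF, fun G _ hG => ?_⟩))
      exact (hp.compatible F G hG x).2.symm
  have hself : ∀ (F : Finset Γ) x, Q F x = p F x := fun F x => by
    refine tendsto_nhds_unique (hQ F x)
        (tendsto_const_nhds.congr' (eventually_finsetsIn.2 ⟨F, subset_rfl, fun G hG hF => ?_⟩))
    rw [Finset.Subset.antisymm hF (Finset.coe_subset.1 hG)]
  have hcl : ∀ B x, Q B x ∈ closure (⋃ F : {F : Finset Γ // ↑F ⊆ B}, range (Q F)) := by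
    refine fun B x => mem_closure_of_tendsto (hQ B x)
      (eventually_finsetsIn.2 ⟨∅, by simp, fun F hF _ => mem_iUnion.2 ⟨⟨F, hF⟩, x, hself F x⟩⟩)
  refine ⟨Q, fun A B hAB x => ⟨?_, ?_⟩, fun A hA => ?_, fun B x => ?_, hcl, fun x => ?_,
    fun f => ?_⟩
  · refine tendsto_nhds_unique (hQ A (Q B x)) ((hQ A x).congr'
      (eventually_finsetsIn.2 ⟨∅, by simp, fun F hF _ => (hin (hF.trans hAB) x).1.symm⟩))
  · refine tendsto_nhds_unique (((Q B).continuous.tendsto _).comp (hQ A x)) ((hQ A x).congr'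
      (eventually_finsetsIn.2 ⟨∅, by simp, fun F hF _ => (hin (hF.trans hAB) x).2.symm⟩))
  · have hfin : {F : Finset Γ | (F : Set Γ) ⊆ A}.Countable :=
      ((countable_ofPred_finite_subset hA).preimage Finset.coe_injective).mono
        fun F (hF : (F : Set Γ) ⊆ A) => And.intro F.finite_toSet hF
    have : Countable {F : Finset Γ // (F : Set Γ) ⊆ A} := hfin.to_subtype
    refine TopologicalSpace.IsSeparable.mono (TopologicalSpace.IsSeparable.closure
      (TopologicalSpace.IsSeparable.iUnion fun F : {F : Finset Γ // (F : Set Γ) ⊆ A} =>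
        hp.separable F.1)) ?_
    rintro _ ⟨x, rfl⟩
    have := hcl A x
    rwa [iUnion_congr fun F : {F : Finset Γ // (F : Set Γ) ⊆ A} =>
      congrArg range (funext (hself F.1))] at this
  -- The union of finite sets `G n` witnessing accuracy 1/(n+1) determines the limit over any E
  -- between it and B.
  · have h : ∀ n : ℕ, ∃ G : Finset Γ, ↑G ⊆ B ∧
        ∀ F : Finset Γ, ↑F ⊆ B → G ⊆ F → dist (p F x) (Q B x) < 1 / (n + 1 : ℝ) := fun n =>
      eventually_finsetsIn.1 (Metric.tendsto_nhds.1 (hQ B x) _ Nat.one_div_pos_of_nat)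
    choose G hGB hG using h
    refine ⟨⋃ n, G n, iUnion_subset hGB, countable_iUnion fun n => (G n).countable_toSet,
      fun E hCE hEB => ?_⟩
    refine tendsto_nhds_unique (hQ E x) (Metric.tendsto_nhds.2 fun ε hε => ?_)
    obtain ⟨n, hn⟩ := exists_nat_one_div_lt hε
    exact eventually_finsetsIn.2 ⟨G n, (subset_iUnion _ n).trans hCE,
      fun F hF hGF => (hG n F (hF.trans hEB) hGF).trans hn⟩
  · obtain ⟨s, hs⟩ := hp.cover x
    refine tendsto_nhds_unique (hQ univ x) (tendsto_const_nhds.congr'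
      (eventually_finsetsIn.2 ⟨{s}, by simp, fun F _ hF => (hs F (hF (by simp))).symm⟩))
  · obtain ⟨s, hs⟩ := hp.full f
    refine ⟨s, fun B hB x => ?_⟩
    refine tendsto_nhds_unique ((f.continuous.tendsto _).comp (hQ B x))
      (tendsto_const_nhds.congr' (eventually_finsetsIn.2
        ⟨{s}, by simpa using hB, fun F _ hF => (hs F (hF (by simp)) x).symm⟩))

end IsFinsetSkeleton

/-! ### Countable dependence of functionals and transfinite assembly -/

namespace IsSetSkeleton

variable {𝕜 X Γ : Type*} [RCLike 𝕜] [NormedAddCommGroup X] [NormedSpace 𝕜 X]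
  {Q : Set Γ → X →L[𝕜] X}

theorem exists_countable_of_isSeparable (hQ : IsSetSkeleton Q) (B : Set Γ) {Y : Set X}
    (hY : TopologicalSpace.IsSeparable Y) :
    ∃ C ⊆ B, C.Countable ∧ ∀ E, C ⊆ E → E ⊆ B → ∀ x ∈ Y, Q E x = Q B x := by
  obtain ⟨c, hc, hYc⟩ := hY
  choose C hCB hC hCE using hQ.exists_countable B
  refine ⟨⋃ x ∈ c, C x, iUnion₂_subset fun x _ => hCB x, hc.biUnion fun x _ => hC x,
    fun E h hEB x hx => ?_⟩
  have : EqOn (Q E) (Q B) c := fun y hy =>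
    hCE y E ((subset_biUnion_of_mem (u := fun x => C x) hy).trans h) hEB
  exact this.closure (Q E).continuous (Q B).continuous (hYc hx)

/-- Each functional composed with `Q B` only depends on a countable subset of `B`. -/
theorem exists_countable_comp (hQ : IsSetSkeleton Q) (B : Set Γ) (f : StrongDual 𝕜 X) :
    ∃ C ⊆ B, C.Countable ∧ ∀ E, C ⊆ E → E ⊆ B → ∀ x, f (Q E x) = f (Q B x) := by
  have h : ∀ S : Set Γ, ∃ C ⊆ B, C.Countable ∧
      (S.Countable → ∀ E, C ⊆ E → E ⊆ B → ∀ x, Q E (Q S x) = Q B (Q S x)) := by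
    intro S
    by_cases hS : S.Countable
    · obtain ⟨C, hCB, hC, hCE⟩ := hQ.exists_countable_of_isSeparable B (hQ.separable S hS)
      exact ⟨C, hCB, hC, fun _ E h1 h2 x => hCE E h1 h2 _ (mem_range_self x)⟩
    · exact ⟨∅, empty_subset _, countable_empty, fun h => absurd h hS⟩
  choose Φ hΦB hΦ hΦE using h
  -- Close {s} off to a countable S = ⋃ S n containing some C ⊆ B with Q C = Q B on the range of Q
  -- S. Since s ∈ S, f Q C = f Q C Q S = f Q B Q S = f Q B. The set S need not lie in B.
  obtain ⟨s, hs⟩ := hQ.full (f.comp (Q B))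
  let S : ℕ → Set Γ := fun n => (fun A => A ∪ Φ A)^[n] {s}
  have hS : ∀ n, S (n + 1) = S n ∪ Φ (S n) := fun n => Function.iterate_succ_apply' _ _ _
  have hmono : Monotone S := monotone_nat_of_le_succ fun n => by
    rw [hS]; exact subset_union_left
  have hSc : ∀ n, (S n).Countable := fun n => by
    induction n with
    | zero => exact countable_singleton s
    | succ n ih => rw [hS]; exact ih.union (hΦ _)
  let C := ⋃ n, Φ (S n)
  have hCB : C ⊆ B := iUnion_subset fun n => hΦB _
  have hCS : C ⊆ ⋃ n, S n := iUnion_subset fun n =>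
    (subset_union_right.trans (hS n).ge).trans (subset_iUnion S (n + 1))
  have hsS : s ∈ ⋃ n, S n := mem_iUnion.2 ⟨0, mem_singleton s⟩
  have key : ∀ y, Q C (Q (⋃ n, S n) y) = Q B (Q (⋃ n, S n) y) := by
    intro y
    have heq : EqOn (Q C) (Q B) (⋃ F : {F : Finset Γ // ↑F ⊆ ⋃ n, S n}, range (Q F)) := by
      intro z hz
      obtain ⟨⟨F, hF⟩, x, rfl⟩ := mem_iUnion.1 hz
      obtain ⟨n, hn⟩ := (hmono.directed_le).exists_mem_subset_of_finset_subset_biUnion hF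
      rw [← (hQ.compatible F (S n) hn x).2]
      exact hΦE _ (hSc n) C (subset_iUnion (fun n => Φ (S n)) n) hCB _
    exact heq.closure (Q C).continuous (Q B).continuous (hQ.mem_closure _ y)
  have hfC : ∀ x, f (Q C x) = f (Q B x) := fun x => by
    have h1 : f (Q B (Q (⋃ n, S n) x)) = f (Q B x) := hs _ hsS x
    rw [← h1, ← key, (hQ.compatible C _ hCS x).1]
  refine ⟨C, hCB, countable_iUnion fun n => hΦ _, fun E hCE hEB x => ?_⟩
  have h1 : f (Q B (Q E x)) = f (Q E x) := by rw [(hQ.compatible E B hEB x).2]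
  rw [← h1, ← hfC, (hQ.compatible C E hCE x).1, hfC]

/-- A functional changes at only countably many steps along a well-ordered filtration. -/
theorem countable_setOf_ne (hQ : IsSetSkeleton Q) {ι : Type*} [LinearOrder ι]
    [WellFoundedLT ι] {e : ι → Γ} (f : StrongDual 𝕜 X) :
    {i | ∃ x, f (Q (e '' Iic i) x) ≠ f (Q (e '' Iio i) x)}.Countable := by
  set J := {i | ∃ x, f (Q (e '' Iic i) x) ≠ f (Q (e '' Iio i) x)}
  have key : ∀ I : Set ι, IsLowerSet I → (∀ i ∈ I, (J ∩ Iio i).Countable) →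
      (J ∩ I).Countable := by
    intro I hI hJ
    obtain ⟨C, hCI, hC, hCE⟩ := hQ.exists_countable_comp (e '' I) f
    obtain ⟨D, hDI, hD, rfl⟩ : ∃ D ⊆ I, D.Countable ∧ e '' D = C := by
      obtain ⟨D, hDI, hinj⟩ := exists_subset_bijOn (I ∩ e ⁻¹' C) e
      have him : e '' (I ∩ e ⁻¹' C) = C := by
        rw [image_inter_preimage]; exact inter_eq_right.2 hCI
      rw [him] at hinj
      exact ⟨D, hDI.trans inter_subset_left,
        countable_of_injective_of_countable_image hinj.injOn (hinj.image_eq ▸ hC),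
        hinj.image_eq⟩
    refine (hD.biUnion fun i hi => ((hJ i (hDI hi)).union (countable_singleton i))).mono ?_
    rintro i ⟨⟨x, hx⟩, hiI⟩
    by_contra hi
    simp only [mem_iUnion, not_exists] at hi
    -- If i lies strictly above D, both segments at i contain the determining set, so f cannot
    -- change there.
    have hlt : D ⊆ Iio i := by
      intro j hj
      by_contra hji
      rcases (not_lt.1 hji).lt_or_eq with h | h
      · exact hi j hj (Or.inl ⟨⟨x, hx⟩, h⟩)
      · exact hi j hj (Or.inr h)
    apply hx
    rw [hCE (e '' Iic i) (image_mono (hlt.trans Iio_subset_Iic_self))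
        (image_mono fun j hj => hI hj hiI),
      hCE (e '' Iio i) (image_mono hlt) (image_mono fun j hj => hI (le_of_lt hj) hiI)]
  have hJ : ∀ i, (J ∩ Iio i).Countable := fun i => by
    induction i using WellFoundedLT.induction with
    | ind i ih => exact key _ (isLowerSet_Iio i) ih
  simpa using key univ isLowerSet_univ fun i _ => hJ i

/-- Every range is the closed span of a set on which all functionals are countably supported. -/
theorem exists_range_subset_closure_span (hQ : IsSetSkeleton Q) (B : Set Γ) :
    ∃ M : Set X, range (Q B) ⊆ closure (Submodule.span 𝕜 M : Set X) ∧
      ∀ f : StrongDual 𝕜 X, {x ∈ M | f x ≠ 0}.Countable := by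
  induction hκ : Cardinal.mk B using WellFoundedLT.induction generalizing B with
  | ind κ ih =>
  have hcount : ∀ A : Set Γ, A.Countable → ∃ M : Set X,
      range (Q A) ⊆ closure (Submodule.span 𝕜 M : Set X) ∧
      ∀ f : StrongDual 𝕜 X, {x ∈ M | f x ≠ 0}.Countable := fun A hA => by
    obtain ⟨M, hM, hsub⟩ := hQ.separable A hA
    exact ⟨M, hsub.trans (closure_mono Submodule.subset_span), fun f => hM.mono (sep_subset _ _)⟩
  by_cases hB : B.Countable
  · exact hcount B hB
  have hκ0 : Cardinal.aleph0 < κ := by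
    rw [← hκ]; exact not_le.1 fun h => hB (Cardinal.le_aleph0_iff_set_countable.1 h)
  let ι := κ.ord.ToType
  obtain ⟨e'⟩ : Nonempty (ι ≃ B) := Cardinal.eq.1 (by rw [hκ]; exact Cardinal.mk_ord_toType κ)
  let e : ι → Γ := fun i => e' i
  have he : e '' univ = B := by
    rw [image_univ]; exact (e'.surjective.range_comp Subtype.val).trans Subtype.range_coe
  -- Proper initial segments of an initial ordinal are smaller than κ, and adding one point is
  -- harmless as κ is infinite.
  have hsmall : ∀ i, Cardinal.mk (e '' Iic i) < κ := fun i => by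
    refine Cardinal.mk_image_le.trans_lt ?_
    rw [← Iio_insert]
    refine Cardinal.mk_insert_le.trans_lt (Cardinal.add_lt_of_lt hκ0.le ?_
      (Cardinal.one_lt_aleph0.trans hκ0))
    exact (Cardinal.mk_Iio_lt i (by simp [ι])).trans_eq (Cardinal.mk_ord_toType κ)
  choose N hN hNc using fun i => ih _ (hsmall i) (e '' Iic i) rfl
  obtain ⟨N₀, hN₀, hN₀c⟩ := hcount ∅ countable_empty
  let D : ι → X →L[𝕜] X := fun i => Q (e '' Iic i) - Q (e '' Iio i)
  have hsub : ∀ i, e '' Iio i ⊆ e '' Iic i := fun i => image_mono Iio_subset_Iic_self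
  let M : Set X := N₀ ∪ ⋃ i, D i '' N i
  let V := (Submodule.span 𝕜 M).topologicalClosure
  have hVcl : IsClosed (V : Set X) := Submodule.isClosed_topologicalClosure _
  have hlimit : ∀ I : Set ι, IsLowerSet I → (∀ i ∈ I, ∀ x, Q (e '' Iic i) x ∈ V) →
      ∀ x, Q (e '' I) x ∈ V := by
    intro I hI hV x
    refine closure_minimal (iUnion_subset ?_) hVcl (hQ.mem_closure (e '' I) x)
    rintro ⟨F, hF⟩ _ ⟨y, rfl⟩
    -- `Q ∅` may be nonzero; `N₀` accounts for its range. A nonempty finite set lies below its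
    -- largest index.
    rcases F.eq_empty_or_nonempty with rfl | hne
    · have h0 : Submodule.span 𝕜 N₀ ≤ Submodule.span 𝕜 M := Submodule.span_mono subset_union_left
      have := closure_mono (SetLike.coe_subset_coe.2 h0) (hN₀ (mem_range_self y))
      simpa [V] using this
    · have : ∃ i ∈ I, ↑F ⊆ e '' Iic i := by
        classical
        obtain ⟨G, hGI, rfl⟩ := Finset.subset_set_image_iff.1 hF
        have hGne : G.Nonempty := Finset.image_nonempty.1 hne
        refine ⟨G.max' hGne, hGI (G.max'_mem hGne), ?_⟩
        rw [Finset.coe_image]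
        exact image_mono fun j hj => G.le_max' j hj
      obtain ⟨i, hi, hFi⟩ := this
      rw [← (hQ.compatible F _ hFi y).2]
      exact hV i hi _
  have hmem : ∀ i x, Q (e '' Iic i) x ∈ V := fun i => by
    induction i using WellFoundedLT.induction with
    | ind i hi =>
    intro x
    have h1 : D i (Q (e '' Iic i) x) ∈ V := by
      have hle : Submodule.span 𝕜 (N i) ≤ V.comap (D i : X →ₗ[𝕜] X) :=
        Submodule.span_le.2 fun y hy => Submodule.le_topologicalClosure _
          (Submodule.subset_span (Or.inr (mem_iUnion.2 ⟨i, y, hy, rfl⟩)))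
      exact closure_minimal (t := D i ⁻¹' V) hle (hVcl.preimage (D i).continuous)
        (hN i (mem_range_self x))
    have h2 := hlimit (Iio i) (isLowerSet_Iio i) hi x
    have h3 : D i (Q (e '' Iic i) x) = Q (e '' Iic i) x - Q (e '' Iio i) x := by
      simp only [D, sub_apply, (hQ.compatible _ _ subset_rfl x).1,
        (hQ.compatible _ _ (hsub i) x).1]
    have h4 := V.add_mem h1 h2
    rwa [h3, sub_add_cancel] at h4
  refine ⟨M, ?_, fun f => ?_⟩
  · rintro _ ⟨x, rfl⟩
    rw [← he]
    exact hlimit univ isLowerSet_univ (fun i _ => hmem i) x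
  · have hJ := hQ.countable_setOf_ne (e := e) f
    -- If f (D i y) ≠ 0, then i is one of the countably many steps at which f changes, and y lies in
    -- the countable support of f ∘ D i on `N i`.
    refine ((hN₀c f).union (hJ.biUnion fun i _ =>
      ((hNc i (f.comp (D i))).image (D i)))).mono ?_
    rintro x ⟨hx | hx, hfx⟩
    · exact Or.inl ⟨hx, hfx⟩
    · obtain ⟨i, y, hy, rfl⟩ := mem_iUnion.1 hx
      refine Or.inr (mem_iUnion₂.2 ⟨i, ⟨y, fun h => hfx ?_⟩, y, ⟨hy, hfx⟩, rfl⟩)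
      simp [D, h]

end IsSetSkeleton

theorem corollaryC {𝕜 X Γ : Type*} [RCLike 𝕜] [NormedAddCommGroup X] [NormedSpace 𝕜 X]
    [CompleteSpace X] [PartialOrder Γ] (P : Γ → X →L[𝕜] X) (hP : IsProjectionalSkeleton P)
    (hfull : hP.inducedSubspace = ⊤) :
    IsSigmaSubspace (⊤ : Submodule 𝕜 (StrongDual 𝕜 X)) ∧ IsWeaklyLindelofDetermined 𝕜 X := by
  suffices h : IsSigmaSubspace (⊤ : Submodule 𝕜 (StrongDual 𝕜 X)) from ⟨h, h⟩
  obtain ⟨p, hp⟩ := hP.exists_isFinsetSkeleton hfull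
  obtain ⟨Q, hQ⟩ := hp.exists_isSetSkeleton
  obtain ⟨M, hM, hMc⟩ := hQ.exists_range_subset_closure_span univ
  refine ⟨M, top_unique fun x _ => hM ⟨x, hQ.apply_univ x⟩, ?_⟩
  ext f
  simpa using hMc f
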